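/- A locally compact contraction group is a pair $(G,\alpha)$ of a locally compact Hausdorff topological group $G$ and an automorphism $\alpha$ of $G$ (a group automorphism that is continuous with continuous inverse) such that $\lim_{k\to\infty}\alpha^k(x)=e$ for every $x\in G$. An isomorphism $(G,\alpha)\to(H,\beta)$ of contraction groups is an isomorphism of topological groups $\phi\colon G\to H$ with $\beta\circ\phi=\phi\circ\alpha$. Let $\mathbb{P}$ be the set of primes, $\mathbb{N}=\{1,2,\ldots\}$ and $\mathbb{N}_0=\mathbb{N}\cup\{0\}$. For $p\in\mathbb{P}$ and $n\in\mathbb{N}$ let $F_{p^n}:=\mathbb{Z}/p^n\mathbb{Z}$ and let $F_{p^n}(\!(t)\!):=F_{p^n}^{(-\mathbb{N})}\times F_{p^n}^{\mathbb{N}_0}$, where the group $F_{p^n}^{(-\mathbb{N})}$ of finitely supported sequences is discrete and $F_{p^n}^{\mathbb{N}_0}$ carries the compact product topology; let $\alpha_{p^n}\colon (x_i)_{i\in\mathbb{Z}}\mapsto(x_{i-1})_{i\in\mathbb{Z}}$ be the right shift on it. (a) For each family $\nu=(\nu(p,n))_{(p,n)\in\mathbb{P}\times\mathbb{N}}$ of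 numbers in $\mathbb{N}_0$ of which only finitely many are non-zero, the (finite) direct sum $$\bigoplus_{p\in\mathbb{P}}\bigoplus_{n\in\mathbb{N}}\bigl(F_{p^n}(\!(t)\!),\alpha_{p^n}\bigr)^{\nu(p,n)},$$ with the right shift in each component, is a locally compact contraction group which is abelian and a torsion group. (b) Every locally compact contraction group which is abelian and a torsion group is isomorphic, as a contraction group, to one of the contraction groups in (a), for a uniquely determined finitely supported family $\nu$. (c) Up to isomorphism of contraction groups, there are only countably many locally compact contraction groups which are abelian and torsion groups. -/

import Mathlib

open Filter Topology

universe u v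

noncomputable section

/-- The pair `(G, α)` is a locally compact (Hausdorff) abelian contraction group whose underlying
group is a torsion group. The type `G ≃ₜ+ G` consists of the group automorphisms of `G` which are
continuous together with their inverses. -/
structure IsLCATorsionContractionGroup (G : Type u) [AddCommGroup G] [TopologicalSpace G]
    (α : G ≃ₜ+ G) : Prop where
  isTopologicalAddGroup : IsTopologicalAddGroup G
  t2Space : T2Space G
  locallyCompactSpace : LocallyCompactSpace G
  isTorsion : ∀ x : G, IsOfFinAddOrder x
  contractive : ∀ x : G, Tendsto (fun k : ℕ => (α : G → G)^[k] x) atTop (𝓝 0)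

/-- `(G, α)` and `(H, β)` are isomorphic as contraction groups. -/
def ContractionIso {G : Type u} {H : Type v} [AddCommGroup G] [TopologicalSpace G]
    [AddCommGroup H] [TopologicalSpace H] (α : G ≃ₜ+ G) (β : H ≃ₜ+ H) : Prop :=
  ∃ φ : G ≃ₜ+ H, ∀ x : G, φ (α x) = β (φ x)

/-- The class of all locally compact abelian torsion contraction groups (in a given universe). -/
structure LCATorsionContractionGroup : Type (u + 1) where
  carrier : Type u
  [addCommGroup : AddCommGroup carrier]
  [topologicalSpace : TopologicalSpace carrier]
  aut : carrier ≃ₜ+ carrier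
  prop : IsLCATorsionContractionGroup carrier aut

attribute [instance] LCATorsionContractionGroup.addCommGroup
  LCATorsionContractionGroup.topologicalSpace

/-- Isomorphism of contraction groups, as an equivalence relation. -/
instance LCATorsionContractionGroup.isoSetoid : Setoid LCATorsionContractionGroup.{u} where
  r A B := ContractionIso A.aut B.aut
  iseqv :=
    { refl := fun A => ⟨ContinuousAddEquiv.refl A.carrier, fun _ => rfl⟩
      symm := by
        rintro A B ⟨φ, h⟩
        refine ⟨φ.symm, fun y => ?_⟩
        apply φ.injective
        rw [h, φ.apply_symm_apply, φ.apply_symm_apply]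
      trans := by
        rintro A B C ⟨φ, h⟩ ⟨ψ, k⟩
        refine ⟨φ.trans ψ, fun x => ?_⟩
        change ψ (φ (A.aut x)) = C.aut (ψ (φ x))
        rw [h, k] }

/-- The group `F^(-ℕ) × F^ℕ₀` (additively, formal Laurent series over `F`). An element `x`
encodes the two-sided sequence with entry `x.1 k` at place `-(k + 1)` and entry `x.2 j` at
place `j`, for `k, j = 0, 1, 2, …`. -/
def TwoSidedPower (F : Type u) [AddCommGroup F] : Type u := (ℕ →₀ F) × (ℕ → F)

namespace TwoSidedPower

variable (F : Type u) [AddCommGroup F]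

instance : AddCommGroup (TwoSidedPower F) := inferInstanceAs (AddCommGroup ((ℕ →₀ F) × (ℕ → F)))

/-- The product of the discrete topology on `F^(-ℕ)` and the product topology on `F^ℕ₀`, each
factor `F` being discrete. -/
instance : TopologicalSpace (TwoSidedPower F) :=
  @instTopologicalSpaceProd (ℕ →₀ F) (ℕ → F) ⊥ (@Pi.topologicalSpace ℕ (fun _ => F) fun _ => ⊥)

/-- The right shift, moving the entry at place `i` to place `i + 1`. -/
def shift : TwoSidedPower F ≃ₜ+ TwoSidedPower F where
  toFun x := (x.1.comapDomain Nat.succ Nat.succ_injective.injOn,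
    fun j => Nat.casesOn j (x.1 0) x.2)
  invFun x := (Finsupp.single 0 (x.2 0) + x.1.mapDomain Nat.succ, fun j => x.2 (j + 1))
  left_inv x := by
    refine Prod.ext (Finsupp.ext fun k => ?_) rfl
    cases k with
    | zero =>
      have : (0 : ℕ) ∉ Set.range Nat.succ := by simp
      simp [Finsupp.mapDomain_of_notMem_range _ _ this]
    | succ k =>
      simp [← Nat.succ_eq_add_one, Finsupp.mapDomain_apply Nat.succ_injective]
  right_inv x := by
    have h0 : (0 : ℕ) ∉ Set.range Nat.succ := by simp
    refine Prod.ext (Finsupp.ext fun k => ?_) (funext fun j => ?_)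
    · simp [Finsupp.mapDomain_apply Nat.succ_injective]
    · cases j with
      | zero => simp [Finsupp.mapDomain_of_notMem_range _ _ h0]
      | succ j => rfl
  map_add' x y := by
    refine Prod.ext (Finsupp.ext fun k => rfl) (funext fun j => ?_)
    cases j <;> rfl
  continuous_toFun := by
    let : TopologicalSpace F := ⊥
    let : TopologicalSpace (ℕ →₀ F) := ⊥
    have : DiscreteTopology (ℕ →₀ F) := ⟨rfl⟩
    change Continuous fun x : (ℕ →₀ F) × (ℕ → F) =>
      ((x.1.comapDomain Nat.succ Nat.succ_injective.injOn,
        fun j => Nat.casesOn j (x.1 0) x.2) : (ℕ →₀ F) × (ℕ → F))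
    refine Continuous.prodMk ?_ (continuous_pi fun j => ?_)
    · exact (continuous_of_discreteTopology
        (f := fun u : ℕ →₀ F => u.comapDomain Nat.succ Nat.succ_injective.injOn)).comp
        continuous_fst
    · cases j with
      | zero =>
        exact (continuous_of_discreteTopology (f := fun u : ℕ →₀ F => u 0)).comp continuous_fst
      | succ j => exact (continuous_apply j).comp continuous_snd
  continuous_invFun := by
    let : TopologicalSpace F := ⊥
    have : DiscreteTopology F := ⟨rfl⟩
    let : TopologicalSpace (ℕ →₀ F) := ⊥
    have : DiscreteTopology (ℕ →₀ F) := ⟨rfl⟩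
    change Continuous fun x : (ℕ →₀ F) × (ℕ → F) =>
      ((Finsupp.single 0 (x.2 0) + x.1.mapDomain Nat.succ, fun j => x.2 (j + 1)) :
        (ℕ →₀ F) × (ℕ → F))
    refine Continuous.prodMk ?_ (continuous_pi fun j => ?_)
    · exact (continuous_of_discreteTopology
        (f := fun q : (ℕ →₀ F) × F => Finsupp.single 0 q.2 + q.1.mapDomain Nat.succ)).comp
        (continuous_fst.prodMk ((continuous_apply 0).comp continuous_snd))
    · exact (continuous_apply (j + 1)).comp continuous_snd

end TwoSidedPower

/-- The index set of the summands of `⊕_p ⊕_n (ℤ/pⁿℤ)((t))^ν(p,n)`, where `p` ranges over the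
primes and `n` over the positive integers. -/
abbrev SummandIndex (ν : Nat.Primes × ℕ+ →₀ ℕ) : Type :=
  Σ q : Nat.Primes × ℕ+, Fin (ν q)

/-- There are only finitely many summands. -/
instance SummandIndex.finite (ν : Nat.Primes × ℕ+ →₀ ℕ) : Finite (SummandIndex ν) := by
  refine Finite.of_injective
    (fun i : SummandIndex ν => (⟨⟨i.1, ?_⟩, i.2⟩ : Σ q : ν.support, Fin (ν q.1))) ?_
  · rw [Finsupp.mem_support_iff]
    exact fun h => (Fin.cast h i.2).elim0
  · rintro ⟨q, i⟩ ⟨r, j⟩ h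
    simp only [Sigma.mk.injEq, Subtype.mk.injEq] at h
    obtain ⟨rfl, h⟩ := h
    rw [eq_of_heq h]

/-- The direct sum `⊕_p ⊕_n (ℤ/pⁿℤ)((t))^ν(p,n)`. As it has only finitely many summands, it is
their product, with the product topology. -/
abbrev LaurentSum (ν : Nat.Primes × ℕ+ →₀ ℕ) : Type :=
  (i : SummandIndex ν) → TwoSidedPower (ZMod ((i.1.1 : ℕ) ^ (i.1.2 : ℕ)))

/-- The right shift in each component of `⊕_p ⊕_n (ℤ/pⁿℤ)((t))^ν(p,n)`. -/
def LaurentSum.shift (ν : Nat.Primes × ℕ+ →₀ ℕ) : LaurentSum ν ≃ₜ+ LaurentSum ν where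
  toFun x i := TwoSidedPower.shift _ (x i)
  invFun x i := (TwoSidedPower.shift _).symm (x i)
  left_inv x := funext fun i => (TwoSidedPower.shift _).symm_apply_apply (x i)
  right_inv x := funext fun i => (TwoSidedPower.shift _).apply_symm_apply (x i)
  map_add' x y := funext fun i => map_add (TwoSidedPower.shift _) (x i) (y i)
  continuous_toFun := continuous_pi fun i =>
    (TwoSidedPower.shift _).continuous_toFun.comp (continuous_apply i)
  continuous_invFun := continuous_pi fun i =>
    (TwoSidedPower.shift _).continuous_invFun.comp (continuous_apply i)

end

/-!
Letting `X` act as `α`, a Laurent series `∑ fᵢ Xⁱ` acts on a contraction group `G` by the sums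
`∑ fᵢ αⁱ(x)`, which converge because `αⁱ(x) → 0` and `G` has arbitrarily small compact open
subgroups: torsion provides one compact open subgroup, and `α` shrinks it. Thus `G` is a module
over the principal ideal domain `ℤ⸨X⸩`.

Finitely many translates of `α(W)` cover a compact open subgroup `W`. With the translating elements
as digits, every element of `W` has an expansion `∑ αⁿ(dₙ)`, so `G` is a finitely generated module.
By Baire's theorem, the `m`-torsion subgroup is open for some `m ≠ 0`; as iterates of `α` move every
element into it, `m` annihilates `G`. The prime divisors of `m` in `ℤ⸨X⸩` are the rational primes,
so the structure theorem yields a finite direct sum of modules `ℤ⸨X⸩ / (pⁿ)`, and these are the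
groups `(ℤ/pⁿ)((t))` with the shift.

Linear maps are continuous, again by the digit expansion, so isomorphisms of contraction groups are
the same as linear equivalences. The multiplicities are therefore determined by the lengths of the
modules `G / pᵏG`.
-/

open scoped Pointwise LaurentSeries PowerSeries

section CompactOpenSubgroup

variable {G : Type*} [AddCommGroup G]

theorem exists_addSubgroup_coe_eq_add {U : Set G} {Z : AddSubgroup G} (h0 : 0 ∈ U)
    (hneg : ∀ x ∈ U, -x ∈ U) (hadd : U + U ⊆ U + (Z : Set G)) :
    ∃ W : AddSubgroup G, (W : Set G) = U + (Z : Set G) := by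
  refine ⟨⟨⟨⟨U + (Z : Set G), ?_⟩, ?_⟩, ?_⟩, rfl⟩
  · rintro _ _ ⟨x, hx, z, hz, rfl⟩ ⟨y, hy, w, hw, rfl⟩
    obtain ⟨u, hu, t, ht, h⟩ := hadd (Set.add_mem_add hx hy)
    refine ⟨u, hu, t + (z + w), Z.add_mem ht (Z.add_mem hz hw), ?_⟩
    change u + (t + (z + w)) = (x + z) + (y + w)
    rw [← add_assoc, show u + t = x + y from h, add_add_add_comm]
  · exact ⟨0, h0, 0, Z.zero_mem, add_zero 0⟩
  · rintro _ ⟨x, hx, z, hz, rfl⟩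
    exact ⟨-x, hneg x hx, -z, Z.neg_mem hz, (neg_add x z).symm⟩

theorem finite_addSubgroup_closure_of_isTorsion (ht : ∀ x : G, IsOfFinAddOrder x)
    (F : Finset G) : Finite (AddSubgroup.closure (F : Set G)) :=
  AddCommGroup.finite_of_fg_isAddTorsion _ fun x =>
    (AddSubmonoid.isOfFinAddOrder_coe (H := (AddSubgroup.closure (F : Set G)).toAddSubmonoid)).1
      (ht (x : G))

variable [TopologicalSpace G] [IsTopologicalAddGroup G]

theorem exists_finset_add_subset_add_closure {K U : Set G} (hK : IsCompact K) (hU : U ∈ 𝓝 0) :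
    ∃ F : Finset G, K ⊆ U + (F : Set G) := by
  obtain ⟨F, -, hF⟩ := hK.elim_nhds_subcover (fun x => (fun y => y - x) ⁻¹' U) fun x _ =>
    (continuous_id.sub continuous_const).continuousAt.preimage_mem_nhds (by simpa using hU)
  refine ⟨F, fun y hy => ?_⟩
  obtain ⟨f, hf, hfy⟩ := Set.mem_iUnion₂.1 (hF hy)
  exact ⟨y - f, hfy, f, hf, sub_add_cancel y f⟩

theorem exists_isCompact_isOpen_addSubgroup_of_isTorsion [LocallyCompactSpace G]
    (ht : ∀ x : G, IsOfFinAddOrder x) :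
    ∃ W : AddSubgroup G, IsCompact (W : Set G) ∧ IsOpen (W : Set G) := by
  obtain ⟨K, hK, hKn⟩ := exists_compact_mem_nhds (0 : G)
  have hUc : IsCompact (K ∪ -K) := hK.union hK.neg
  have hUn : K ∪ -K ∈ 𝓝 (0 : G) := mem_of_superset hKn Set.subset_union_left
  obtain ⟨F, hF⟩ := exists_finset_add_subset_add_closure (hUc.add hUc) hUn
  have := finite_addSubgroup_closure_of_isTorsion ht F
  obtain ⟨W, hW⟩ := exists_addSubgroup_coe_eq_add (U := K ∪ -K)
    (Z := AddSubgroup.closure (F : Set G)) (mem_of_mem_nhds hUn)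
    (fun x hx => by simpa [or_comm] using hx)
    (hF.trans (Set.add_subset_add_left AddSubgroup.subset_closure))
  refine ⟨W, hW ▸ hUc.add (Set.toFinite _).isCompact, W.isOpen_of_mem_nhds (g := 0) ?_⟩
  refine mem_of_superset hUn fun x hx => hW ▸ ⟨x, hx, 0, zero_mem _, add_zero x⟩

end CompactOpenSubgroup

section Contraction

variable {G : Type*} [AddCommGroup G] [TopologicalSpace G] {α : G ≃ₜ+ G}

theorem continuous_zsmul_toAddEquiv (α : G ≃ₜ+ G) (i : ℤ) :
    Continuous (i • (α.toAddEquiv : AddAut G) : AddAut G) := by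
  induction i with
  | zero => rw [zero_zsmul]; exact continuous_id
  | succ n ih => rw [add_zsmul, one_zsmul]; exact ih.comp α.continuous_toFun
  | pred n ih => rw [sub_zsmul, one_zsmul]; exact ih.comp α.continuous_invFun

/-- The power `α ^ i` of an automorphism of a topological group, for an integer exponent `i`. -/
def intIterate (α : G ≃ₜ+ G) (i : ℤ) : G ≃ₜ+ G where
  __ := (i • (α.toAddEquiv : AddAut G) : AddAut G)
  continuous_toFun := continuous_zsmul_toAddEquiv α i
  continuous_invFun := by
    have := continuous_zsmul_toAddEquiv α (-i)
    rwa [neg_zsmul] at this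

theorem intIterate_add (α : G ≃ₜ+ G) (i j : ℤ) (x : G) :
    intIterate α (i + j) x = intIterate α i (intIterate α j x) :=
  DFunLike.congr_fun (add_zsmul (α.toAddEquiv : AddAut G) i j) x

@[simp]
theorem intIterate_zero (α : G ≃ₜ+ G) (x : G) : intIterate α 0 x = x :=
  DFunLike.congr_fun (zero_zsmul (α.toAddEquiv : AddAut G)) x

@[simp]
theorem intIterate_one (α : G ≃ₜ+ G) (x : G) : intIterate α 1 x = α x :=
  DFunLike.congr_fun (one_zsmul (α.toAddEquiv : AddAut G)) x

theorem intIterate_natCast (α : G ≃ₜ+ G) (n : ℕ) (x : G) :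
    intIterate α n x = (α : G → G)^[n] x := by
  induction n generalizing x with
  | zero => exact intIterate_zero α x
  | succ n ih => rw [Nat.cast_succ, intIterate_add, intIterate_one, ih, Function.iterate_succ_apply]

theorem intIterate_neg_apply_self (α : G ≃ₜ+ G) (i : ℤ) (x : G) :
    intIterate α (-i) (intIterate α i x) = x := by
  rw [← intIterate_add, neg_add_cancel, intIterate_zero]

theorem map_intIterate {H : Type*} [AddCommGroup H] [TopologicalSpace H] {β : H ≃ₜ+ H}
    {φ : G → H} (hφ : ∀ x, φ (α x) = β (φ x)) (i : ℤ) (x : G) :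
    φ (intIterate α i x) = intIterate β i (φ x) := by
  have hnat (n : ℕ) (x : G) : φ (intIterate α n x) = intIterate β n (φ x) := by
    simpa only [intIterate_natCast] using Function.Semiconj.iterate_right hφ n x
  obtain ⟨n, rfl | rfl⟩ := i.eq_nat_or_neg
  · exact hnat n x
  · apply (intIterate β n).injective
    rw [← hnat, ← intIterate_add, ← intIterate_add, add_neg_cancel, intIterate_zero,
      intIterate_zero]

/-- The automorphism `α` is contractive: the orbits of its iterates tend to zero. -/
def IsContraction (α : G ≃ₜ+ G) : Prop :=
  ∀ x : G, Tendsto (fun k : ℕ => (α : G → G)^[k] x) atTop (𝓝 0)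

theorem IsContraction.exists_nsmul_eq_zero [IsTopologicalAddGroup G] [T2Space G]
    [LocallyCompactSpace G] (hα : IsContraction α) (ht : ∀ x : G, IsOfFinAddOrder x) :
    ∃ m : ℕ, 0 < m ∧ ∀ x : G, m • x = 0 := by
  let torsion (n : ℕ) : AddSubgroup G := (nsmulAddMonoidHom (n + 1)).ker
  have isClosed_torsion (n : ℕ) : IsClosed (torsion n : Set G) :=
    isClosed_eq (continuous_const_smul (n + 1)) continuous_const
  have iUnion_torsion : ⋃ n : ℕ, (torsion n : Set G) = Set.univ := by
    refine Set.eq_univ_of_forall fun x => Set.mem_iUnion.2 ?_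
    obtain ⟨n, hn, h⟩ := isOfFinAddOrder_iff_nsmul_eq_zero.1 (ht x)
    exact ⟨n - 1, by simpa [torsion, Nat.sub_add_cancel hn] using h⟩
  obtain ⟨n, x, hx⟩ := nonempty_interior_of_iUnion_of_closed isClosed_torsion iUnion_torsion
  have isOpen_torsion : IsOpen (torsion n : Set G) :=
    (torsion n).isOpen_of_mem_nhds (mem_interior_iff_mem_nhds.1 hx)
  refine ⟨n + 1, n.succ_pos, fun y => ?_⟩
  obtain ⟨k, hk⟩ := ((hα y).eventually_mem (isOpen_torsion.mem_nhds (zero_mem _))).exists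
  rw [SetLike.mem_coe, AddMonoidHom.mem_ker, nsmulAddMonoidHom_apply, ← iterate_map_nsmul] at hk
  exact α.injective.iterate k (hk.trans (iterate_map_zero α k).symm)

theorem IsContraction.exists_interior_forall_iterate_mem [IsTopologicalAddGroup G]
    [LocallyCompactSpace G] (hα : IsContraction α) {V : Set G} (hV : V ∈ 𝓝 0)
    (hVc : IsClosed V) :
    ∃ N : ℕ, (interior {x : G | ∀ n ≥ N, (α : G → G)^[n] x ∈ V}).Nonempty := by
  refine nonempty_interior_of_iUnion_of_closed (fun N => ?_) (Set.eq_univ_of_forall fun x =>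
    Set.mem_iUnion.2 (eventually_atTop.1 ((hα x).eventually_mem hV)))
  simp only [Set.ofPred_forall]
  exact isClosed_iInter fun n => isClosed_iInter fun _ =>
    hVc.preimage (α.continuous_toFun.iterate n)

theorem IsContraction.eventually_forall_iterate_mem [IsTopologicalAddGroup G]
    [LocallyCompactSpace G] (hα : IsContraction α) {K U : Set G} (hK : IsCompact K)
    (hU : U ∈ 𝓝 (0 : G)) : ∀ᶠ n : ℕ in atTop, ∀ x ∈ K, (α : G → G)^[n] x ∈ U := by
  have tendsto_combination :
      Tendsto (fun q : G × G × G => q.1 - q.2.1 + q.2.2) (𝓝 0 ×ˢ 𝓝 0 ×ˢ 𝓝 0) (𝓝 0) := by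
    rw [← nhds_prod_eq, ← nhds_prod_eq]
    exact Continuous.tendsto' (by fun_prop) _ _ (by simp)
  obtain ⟨V', hV', hV'U⟩ : ∃ V ∈ 𝓝 (0 : G), V ×ˢ V ×ˢ V ⊆
      (fun q : G × G × G => q.1 - q.2.1 + q.2.2) ⁻¹' U := by
    obtain ⟨V₁, hV₁, V₂₃, hV₂₃, h₁⟩ := mem_prod_iff.1 (tendsto_combination hU)
    obtain ⟨V₂, hV₂, V₃, hV₃, h₂⟩ := mem_prod_iff.1 hV₂₃
    exact ⟨V₁ ∩ (V₂ ∩ V₃), inter_mem hV₁ (inter_mem hV₂ hV₃), fun q hq =>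
      h₁ ⟨hq.1.1, h₂ ⟨hq.2.1.2.1, hq.2.2.2.2⟩⟩⟩
  obtain ⟨V, hV, hVc, hVV'⟩ := exists_mem_nhds_isClosed_subset hV'
  obtain ⟨N, x₀, hx₀⟩ := hα.exists_interior_forall_iterate_mem hV hVc
  have hN := mem_interior_iff_mem_nhds.1 hx₀
  obtain ⟨F, hF⟩ := exists_finset_add_subset_add_closure (U := (· + x₀) ⁻¹' _) hK
    ((continuous_add_const x₀).continuousAt.preimage_mem_nhds (by simpa using hN))
  have hF_eventually : ∀ᶠ n : ℕ in atTop, ∀ x ∈ F, (α : G → G)^[n] x ∈ V :=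
    (eventually_all_finset F).2 fun x _ => (hα x).eventually_mem hV
  filter_upwards [hF_eventually, eventually_ge_atTop N] with n hFn hn x hx
  obtain ⟨u, hu, f, hf, rfl⟩ := hF hx
  have := hV'U (Set.mk_mem_prod (hVV' (hu n hn))
    (Set.mk_mem_prod (hVV' (mem_of_mem_nhds hN n hn)) (hVV' (hFn f hf))))
  simpa only [Set.mem_preimage, ← iterate_map_sub, ← iterate_map_add, add_sub_cancel_right]
    using this

theorem IsContraction.nonarchimedeanAddGroup [IsTopologicalAddGroup G]
    [LocallyCompactSpace G] (hα : IsContraction α) {W : AddSubgroup G}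
    (hWc : IsCompact (W : Set G)) (hWo : IsOpen (W : Set G)) : NonarchimedeanAddGroup G where
  is_nonarchimedean U hU := by
    obtain ⟨n, hn⟩ := (hα.eventually_forall_iterate_mem hWc hU).exists
    refine ⟨⟨W.map (intIterate α n : G →+ G), ?_⟩, ?_⟩
    · exact (intIterate α n).toHomeomorph.isOpenMap W hWo
    · rintro _ ⟨x, hx, rfl⟩
      exact (intIterate_natCast α n x).symm ▸ hn x hx

theorem exists_isCompact_openAddSubgroup [NonarchimedeanAddGroup G] [LocallyCompactSpace G] :
    ∃ W : OpenAddSubgroup G, IsCompact (W : Set G) := by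
  obtain ⟨K, hK, hKn⟩ := exists_compact_mem_nhds (0 : G)
  obtain ⟨W, hW⟩ := NonarchimedeanAddGroup.is_nonarchimedean K hKn
  exact ⟨W, hK.of_isClosed_subset W.isClosed hW⟩

end Contraction

section LaurentAction

variable {G : Type*} [AddCommGroup G] [TopologicalSpace G]

theorem hasSum_coeff_mul_coeff_sub {R : Type*} [Semiring R] [TopologicalSpace R] (f g : R⸨X⸩)
    (k : ℤ) : HasSum (fun i => f.coeff i * g.coeff (k - i)) ((f * g).coeff k) := by
  rw [HahnSeries.coeff_mul]
  set s := Finset.antidiagonal f.isPWO_support g.isPWO_support k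
  have hs (ij) (h : ij ∈ s) : ij.1 + ij.2 = k := (Finset.mem_antidiagonal.1 h).2.2
  have hfst : Set.InjOn Prod.fst (s : Set (ℤ × ℤ)) := fun x hx y hy hxy =>
    Prod.ext hxy (by have := hs x hx; have := hs y hy; omega)
  have hsum : ∑ ij ∈ s, f.coeff ij.1 * g.coeff ij.2 =
      ∑ i ∈ s.image Prod.fst, f.coeff i * g.coeff (k - i) := by
    rw [Finset.sum_image hfst]
    exact Finset.sum_congr rfl fun ij h => by rw [← hs ij h, add_sub_cancel_left]
  rw [hsum]
  refine hasSum_sum_of_ne_finset_zero fun i hi => ?_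
  by_contra h
  refine hi (Finset.mem_image.2 ⟨(i, k - i), Finset.mem_antidiagonal.2 ⟨?_, ?_, ?_⟩, rfl⟩)
  · exact left_ne_zero_of_mul h
  · exact right_ne_zero_of_mul h
  · exact add_sub_cancel i k

theorem summable_of_forall_finite_setOf_notMem [NonarchimedeanAddGroup G] [LocallyCompactSpace G]
    {ι : Type*} {f : ι → G} (hf : ∀ V : OpenAddSubgroup G, {i | f i ∉ V}.Finite) : Summable f := by
  let := IsTopologicalAddGroup.rightUniformSpace G
  have := isUniformAddGroup_of_addCommGroup (G := G)
  have := IsRightUniformAddGroup.completeSpace_of_weaklyLocallyCompactSpace (G := G)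
  refine NonarchimedeanAddGroup.summable_of_tendsto_cofinite_zero fun U hU => ?_
  obtain ⟨V, hV⟩ := NonarchimedeanAddGroup.is_nonarchimedean U hU
  exact (hf V).subset fun i hi hiV => hi (hV hiV)

/-- The `i`-th term of the series `∑ fᵢ αⁱ(x)` by which a Laurent series `f = ∑ fᵢ Xⁱ` acts on
`x`, with the variable `X` acting as `α`. -/
def laurentTerm (α : G ≃ₜ+ G) (f : ℤ⸨X⸩) (x : G) (i : ℤ) : G :=
  f.coeff i • intIterate α i x

/-- The `ℤ⸨X⸩`-module structure on `G` is the one for which Laurent series act by convergent sums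
of integer multiples of powers of `α`. -/
def IsLaurentAction (α : G ≃ₜ+ G) [Module ℤ⸨X⸩ G] : Prop :=
  ∀ (f : ℤ⸨X⸩) (x : G), HasSum (laurentTerm α f x) (f • x)

section Module

variable [NonarchimedeanAddGroup G] [LocallyCompactSpace G] {α : G ≃ₜ+ G}

theorem IsContraction.eventually_forall_intIterate_mem (hα : IsContraction α) {K U : Set G}
    (hK : IsCompact K) (hU : U ∈ 𝓝 (0 : G)) :
    ∀ᶠ i : ℤ in atTop, ∀ x ∈ K, intIterate α i x ∈ U := by
  obtain ⟨N, hN⟩ := eventually_atTop.1 (hα.eventually_forall_iterate_mem hK hU)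
  filter_upwards [eventually_ge_atTop (N : ℤ)] with i hi x hx
  lift i to ℕ using (Int.natCast_nonneg N).trans hi
  exact (intIterate_natCast α i x).symm ▸ hN i (Int.ofNat_le.1 hi) x hx

theorem IsContraction.exists_forall_intIterate_mem (hα : IsContraction α) (x : G)
    (V : OpenAddSubgroup G) : ∃ N : ℤ, ∀ i ≥ N, intIterate α i x ∈ V :=
  eventually_atTop.1 ((hα.eventually_forall_intIterate_mem isCompact_singleton V.mem_nhds_zero).mono
    fun _ h => h x rfl)

theorem IsContraction.summable_laurentTerm (hα : IsContraction α) (f : ℤ⸨X⸩) (x : G) :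
    Summable (laurentTerm α f x) := by
  refine summable_of_forall_finite_setOf_notMem fun V => ?_
  obtain ⟨N, hN⟩ := hα.exists_forall_intIterate_mem x V
  refine (Set.finite_Ico f.order N).subset fun i hi => ⟨?_, ?_⟩ <;> by_contra! h
  · exact hi (by simp [laurentTerm, HahnSeries.coeff_eq_zero_of_lt_order h])
  · exact hi (V.zsmul_mem (hN i h) _)

theorem IsContraction.summable_mul_laurentTerm (hα : IsContraction α) (f g : ℤ⸨X⸩) (x : G) :
    Summable fun ij : ℤ × ℤ => (f.coeff ij.1 * g.coeff ij.2) • intIterate α (ij.1 + ij.2) x := by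
  refine summable_of_forall_finite_setOf_notMem fun V => ?_
  obtain ⟨N, hN⟩ := hα.exists_forall_intIterate_mem x V
  refine ((Set.finite_Ico f.order (N - g.order)).prod
    (Set.finite_Ico g.order (N - f.order))).subset fun ⟨i, j⟩ hij => ?_
  have hi : f.order ≤ i := by
    by_contra! h
    exact hij (by simp [HahnSeries.coeff_eq_zero_of_lt_order h])
  have hj : g.order ≤ j := by
    by_contra! h
    exact hij (by simp [HahnSeries.coeff_eq_zero_of_lt_order h])
  have hN : i + j < N := by
    by_contra! h
    exact hij (V.zsmul_mem (hN _ h) _)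
  exact ⟨⟨hi, by dsimp only; omega⟩, ⟨hj, by dsimp only; omega⟩⟩

variable [T2Space G]

theorem IsContraction.tsum_laurentTerm_mul (hα : IsContraction α) (f g : ℤ⸨X⸩) (x : G) :
    ∑' k, laurentTerm α (f * g) x k = ∑' i, laurentTerm α f (∑' j, laurentTerm α g x j) i := by
  let t (ij : ℤ × ℤ) : G := (f.coeff ij.1 * g.coeff ij.2) • intIterate α (ij.1 + ij.2) x
  have hsum : HasSum t (∑' ij, t ij) := (hα.summable_mul_laurentTerm f g x).hasSum
  have hrow (i : ℤ) :
      HasSum (fun j => t (i, j)) (laurentTerm α f (∑' j, laurentTerm α g x j) i) := by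
    have := ((hα.summable_laurentTerm g x).hasSum.map (intIterate α i)
      (intIterate α i).continuous_toFun).const_smul (f.coeff i)
    simpa only [Function.comp_def, laurentTerm, map_zsmul, ← intIterate_add, smul_smul] using this
  have hdiag (k : ℤ) : HasSum (fun i => t (i, k - i)) (laurentTerm α (f * g) x k) := by
    simp only [t, add_sub_cancel]
    exact (hasSum_coeff_mul_coeff_sub f g k).map
      ((smulAddHom ℤ G).flip (intIterate α k x)) continuous_of_discreteTopology
  let shear : ℤ × ℤ ≃ ℤ × ℤ :=
    ⟨fun ki => (ki.2, ki.1 - ki.2), fun ij => (ij.1 + ij.2, ij.1), fun ki => by simp,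
      fun ij => by simp⟩
  rw [(hsum.prod_fiberwise hrow).tsum_eq]
  exact ((shear.hasSum_iff.2 hsum).prod_fiberwise hdiag).tsum_eq

/-- The `ℤ⸨X⸩`-module structure on a contraction group for which `X` acts as the contraction. -/
noncomputable abbrev laurentModule (hα : IsContraction α) : Module ℤ⸨X⸩ G where
  smul f x := ∑' i, laurentTerm α f x i
  one_smul x := by
    refine (tsum_eq_single 0 fun i hi => ?_).trans ?_
    · rw [laurentTerm, HahnSeries.coeff_one, if_neg hi, zero_smul]
    · rw [laurentTerm, HahnSeries.coeff_one, if_pos rfl, one_smul, intIterate_zero]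
  mul_smul f g x := hα.tsum_laurentTerm_mul f g x
  smul_zero f := by
    refine (tsum_congr fun i => ?_).trans tsum_zero
    rw [laurentTerm, map_zero, smul_zero]
  smul_add f x y := by
    refine (tsum_congr fun i => ?_).trans
      ((hα.summable_laurentTerm f x).tsum_add (hα.summable_laurentTerm f y))
    rw [laurentTerm, map_add, smul_add, laurentTerm, laurentTerm]
  add_smul f g x := by
    refine (tsum_congr fun i => ?_).trans
      ((hα.summable_laurentTerm f x).tsum_add (hα.summable_laurentTerm g x))
    rw [laurentTerm, HahnSeries.coeff_add, add_smul, laurentTerm, laurentTerm]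
  zero_smul x := by
    refine (tsum_congr fun i => ?_).trans tsum_zero
    rw [laurentTerm, HahnSeries.coeff_zero, zero_smul]

theorem isLaurentAction_laurentModule (hα : IsContraction α) :
    letI := laurentModule hα
    IsLaurentAction α :=
  fun f x => (hα.summable_laurentTerm f x).hasSum

end Module

namespace IsLaurentAction

variable [Module ℤ⸨X⸩ G] {α : G ≃ₜ+ G}

theorem single_smul [T2Space G] (hact : IsLaurentAction α) (i : ℤ) (x : G) :
    (HahnSeries.single i 1 : ℤ⸨X⸩) • x = intIterate α i x := by
  refine (hact _ x).unique ?_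
  convert hasSum_single (f := laurentTerm α (HahnSeries.single i 1) x) i fun j hj => ?_
  · rw [laurentTerm, HahnSeries.coeff_single_same, one_smul]
  · rw [laurentTerm, HahnSeries.coeff_single_of_ne hj, zero_smul]

theorem hasSum_coe_smul (hact : IsLaurentAction α) (f : ℤ⟦X⟧) (x : G) :
    HasSum (fun n : ℕ => PowerSeries.coeff n f • intIterate α n x) ((f : ℤ⸨X⸩) • x) := by
  convert (Nat.cast_injective (R := ℤ)).hasSum_iff (f := laurentTerm α f x) ?_ |>.2
    (hact f x) using 1
  · funext n
    rw [Function.comp_apply, laurentTerm, LaurentSeries.coeff_coe_powerSeries]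
  · intro i hi
    rw [laurentTerm, PowerSeries.coeff_coe, if_pos, zero_smul]
    by_contra! h
    exact hi ⟨i.toNat, Int.toNat_of_nonneg h⟩

theorem coe_smul_mem [IsTopologicalAddGroup G] (hact : IsLaurentAction α) {W : OpenAddSubgroup G}
    {x : G} (hx : ∀ n : ℕ, intIterate α n x ∈ W) (f : ℤ⟦X⟧) : (f : ℤ⸨X⸩) • x ∈ W :=
  W.isClosed.mem_of_tendsto (hact.hasSum_coe_smul f x)
    (.of_forall fun _ => W.toAddSubgroup.sum_mem fun n _ => W.toAddSubgroup.zsmul_mem (hx n) _)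

end IsLaurentAction

end LaurentAction

section Equivariance

variable {G H : Type*} [AddCommGroup G] [TopologicalSpace G] [AddCommGroup H]
  [TopologicalSpace H] [T2Space H] [Module ℤ⸨X⸩ G] [Module ℤ⸨X⸩ H] {α : G ≃ₜ+ G} {β : H ≃ₜ+ H}

theorem IsLaurentAction.linearMap_intIterate [T2Space G] (hG : IsLaurentAction α)
    (hH : IsLaurentAction β) (φ : G →ₗ[ℤ⸨X⸩] H) (i : ℤ) (x : G) :
    φ (intIterate α i x) = intIterate β i (φ x) := by
  rw [← hG.single_smul, map_smul, hH.single_smul]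

theorem IsLaurentAction.map_smul_of_continuous (hG : IsLaurentAction α)
    (hH : IsLaurentAction β) {φ : G →+ H} (hφ : Continuous φ) (hαβ : ∀ x, φ (α x) = β (φ x))
    (f : ℤ⸨X⸩) (x : G) : φ (f • x) = f • φ x := by
  refine ((hG f x).map φ hφ).unique ?_
  have hterm : φ ∘ laurentTerm α f x = laurentTerm β f (φ x) := funext fun i =>
    (map_zsmul φ (f.coeff i) _).trans (congr_arg (f.coeff i • ·) (map_intIterate hαβ i x))
  exact hterm ▸ hH f (φ x)

theorem IsLaurentAction.nonempty_linearEquiv (hG : IsLaurentAction α)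
    (hH : IsLaurentAction β) (h : ContractionIso α β) : Nonempty (G ≃ₗ[ℤ⸨X⸩] H) := by
  obtain ⟨φ, hφ⟩ := h
  exact ⟨{ φ.toAddEquiv with
    map_smul' := hG.map_smul_of_continuous hH (φ := (φ : G →+ H)) φ.continuous_toFun hφ }⟩

end Equivariance

section FiniteGeneration

variable {G : Type*} [AddCommGroup G] [TopologicalSpace G] [NonarchimedeanAddGroup G]
  {α : G ≃ₜ+ G}

theorem exists_finset_forall_exists_add_apply (α : G ≃ₜ+ G) {W : OpenAddSubgroup G}
    (hW : IsCompact (W : Set G)) :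
    ∃ F : Finset G, ∀ x ∈ W, ∃ f ∈ F, ∃ y ∈ W, x = f + α y := by
  classical
  obtain ⟨F, hF⟩ := exists_finset_add_subset_add_closure hW
    (α.toHomeomorph.symm.continuous.continuousAt.preimage_mem_nhds
      (by simpa using W.mem_nhds_zero) : α.symm ⁻¹' (W : Set G) ∈ 𝓝 0)
  refine ⟨F, fun x hx => ?_⟩
  obtain ⟨w, hw, f, hf, rfl⟩ := hF hx
  exact ⟨f, hf, α.symm w, hw, by simp [add_comm]⟩

variable [LocallyCompactSpace G]

theorem IsContraction.exists_digits (hα : IsContraction α) {W : OpenAddSubgroup G}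
    (hW : IsCompact (W : Set G)) {F : Finset G}
    (hF : ∀ x ∈ W, ∃ f ∈ F, ∃ y ∈ W, x = f + α y) {x : G} (hx : x ∈ W) :
    ∃ d : ℕ → G, (∀ n, d n ∈ F) ∧
      Tendsto (fun N => ∑ n ∈ Finset.range N, intIterate α n (d n)) atTop (𝓝 x) := by
  choose! digit digit_mem rest rest_mem eq_add using hF
  have iterate_rest_mem (n : ℕ) : rest^[n] x ∈ W := Set.MapsTo.iterate rest_mem n hx
  have expansion (N : ℕ) : ∑ n ∈ Finset.range N, intIterate α n (digit (rest^[n] x)) =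
      x - intIterate α N (rest^[N] x) := by
    induction N with
    | zero => simp
    | succ N ih =>
      have h := congr_arg (intIterate α N) (eq_add _ (iterate_rest_mem N))
      rw [map_add, ← intIterate_one α (rest _), ← intIterate_add] at h
      rw [Finset.sum_range_succ, ih, h, Function.iterate_succ_apply', Nat.cast_succ]
      abel
  have remainder : Tendsto (fun N : ℕ => intIterate α N (rest^[N] x)) atTop (𝓝 0) := fun U hU =>
    (tendsto_natCast_atTop_atTop.eventually (hα.eventually_forall_intIterate_mem hW hU)).mono
      fun N hN => hN _ (iterate_rest_mem N)
  refine ⟨fun n => digit (rest^[n] x), fun n => digit_mem _ (iterate_rest_mem n), ?_⟩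
  simpa only [expansion, sub_zero] using tendsto_const_nhds.sub remainder

variable [T2Space G] [Module ℤ⸨X⸩ G]

theorem IsContraction.exists_finset_forall_eq_sum_smul (hα : IsContraction α)
    (hact : IsLaurentAction α) {W : OpenAddSubgroup G} (hW : IsCompact (W : Set G)) :
    ∃ F : Finset G, ∀ x ∈ W, ∃ g : G → ℤ⟦X⟧, x = ∑ f ∈ F, (g f : ℤ⸨X⸩) • f := by
  classical
  obtain ⟨F, hF⟩ := exists_finset_forall_exists_add_apply α hW
  refine ⟨F, fun x hx => ?_⟩
  obtain ⟨d, hd, hlim⟩ := hα.exists_digits hW hF hx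
  let g (f : G) : ℤ⟦X⟧ := PowerSeries.mk fun n => if d n = f then 1 else 0
  have hg := hasSum_sum fun f (_ : f ∈ F) => hact.hasSum_coe_smul (g f) f
  have hterm (n : ℕ) :
      ∑ f ∈ F, PowerSeries.coeff n (g f) • intIterate α n f = intIterate α n (d n) := by
    simp [g, PowerSeries.coeff_mk, ite_smul, Finset.sum_ite_eq, hd n]
  refine ⟨g, tendsto_nhds_unique hlim ?_⟩
  simpa only [hterm] using hg.tendsto_sum_nat

theorem IsContraction.finite_of_isLaurentAction (hα : IsContraction α)
    (hact : IsLaurentAction α) : Module.Finite ℤ⸨X⸩ G := by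
  obtain ⟨W, hW⟩ := exists_isCompact_openAddSubgroup (G := G)
  obtain ⟨F, hF⟩ := hα.exists_finset_forall_eq_sum_smul hact hW
  refine ⟨⟨F, eq_top_iff.2 fun x _ => ?_⟩⟩
  obtain ⟨N, hN⟩ := hα.exists_forall_intIterate_mem x W
  obtain ⟨g, hg⟩ := hF _ (hN N le_rfl)
  rw [← intIterate_neg_apply_self α N x, ← hact.single_smul, hg]
  exact Submodule.smul_mem _ _ (Submodule.sum_mem _ fun f hf =>
    Submodule.smul_mem _ _ (Submodule.subset_span hf))

variable {H : Type*} [AddCommGroup H] [TopologicalSpace H] [Module ℤ⸨X⸩ H]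
  [NonarchimedeanAddGroup H] [LocallyCompactSpace H] [T2Space H] {β : H ≃ₜ+ H}

theorem IsContraction.continuous_linearMap (hα : IsContraction α) (hβ : IsContraction β)
    (hG : IsLaurentAction α) (hH : IsLaurentAction β) (φ : G →ₗ[ℤ⸨X⸩] H) : Continuous φ := by
  refine continuous_of_continuousAt_zero φ ?_
  rw [ContinuousAt, map_zero]
  intro U hU
  obtain ⟨V, hV⟩ := NonarchimedeanAddGroup.is_nonarchimedean U hU
  obtain ⟨W, hW⟩ := exists_isCompact_openAddSubgroup (G := G)
  obtain ⟨F, hF⟩ := hα.exists_finset_forall_eq_sum_smul hG hW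
  obtain ⟨k, hk⟩ : ∃ k : ℤ, ∀ f ∈ F, ∀ i ≥ k, intIterate β i (φ f) ∈ V := by
    choose N hN using fun f => hβ.exists_forall_intIterate_mem (φ f) V
    obtain ⟨k, hk⟩ := (F.image N).exists_le
    exact ⟨k, fun f hf i hi => hN f i ((hk _ (Finset.mem_image_of_mem N hf)).trans hi)⟩
  change φ ⁻¹' U ∈ 𝓝 0
  refine mem_of_superset ((map_continuous (intIterate α (-k))).tendsto' 0 0 (map_zero _)
    W.mem_nhds_zero) fun x (hx : intIterate α (-k) x ∈ W) => hV ?_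
  obtain ⟨g, hg⟩ := hF _ hx
  have hφx : φ x = ∑ f ∈ F, (g f : ℤ⸨X⸩) • intIterate β k (φ f) := by
    calc φ x = (HahnSeries.single k 1 : ℤ⸨X⸩) • φ (intIterate α (-k) x) := by
          rw [← map_smul, hG.single_smul, ← intIterate_add, add_neg_cancel, intIterate_zero]
      _ = ∑ f ∈ F, (HahnSeries.single k 1 : ℤ⸨X⸩) • (g f : ℤ⸨X⸩) • φ f := by
          rw [hg, map_sum, Finset.smul_sum]
          simp only [map_smul]
      _ = ∑ f ∈ F, (g f : ℤ⸨X⸩) • intIterate β k (φ f) := by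
          simp only [smul_comm (HahnSeries.single k (1 : ℤ) : ℤ⸨X⸩), hH.single_smul]
  rw [hφx]
  refine V.toAddSubgroup.sum_mem fun f hf => hH.coe_smul_mem (fun n => ?_) _
  rw [← intIterate_add]
  exact hk f hf _ (by omega)

theorem IsContraction.contractionIso_of_linearEquiv (hα : IsContraction α) (hβ : IsContraction β)
    (hG : IsLaurentAction α) (hH : IsLaurentAction β) (φ : G ≃ₗ[ℤ⸨X⸩] H) : ContractionIso α β :=
  ⟨{ φ.toAddEquiv with
      continuous_toFun := hα.continuous_linearMap hβ hG hH φ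
      continuous_invFun := hβ.continuous_linearMap hα hH hG φ.symm },
    fun x => by simpa using hG.linearMap_intIterate hH φ.toLinearMap 1 x⟩

end FiniteGeneration

section LaurentSeriesRing

variable {R : Type*} [CommRing R]

instance isPrincipalIdealRing_laurentSeries [IsPrincipalIdealRing R] :
    IsPrincipalIdealRing R⸨X⸩ := by
  refine IsPrincipalIdealRing.of_prime fun P hP => ?_
  let Q : Ideal R⟦X⟧ := P.under R⟦X⟧
  have hQ : Q.IsPrime := hP.under R⟦X⟧
  have hX : PowerSeries.X ∉ Q := fun h => hP.ne_top <| Ideal.eq_top_of_isUnit_mem P h <|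
    IsLocalization.map_units R⸨X⸩
      (⟨_, Submonoid.mem_powers _⟩ : Submonoid.powers (PowerSeries.X : R⟦X⟧))
  obtain ⟨a, ha⟩ := IsPrincipalIdealRing.principal (Q.map PowerSeries.constantCoeff)
  obtain ⟨T, hT, -, hcard⟩ :=
    PowerSeries.exist_eq_span_eq_ncard_of_X_notMem hX ha.symm (Set.finite_singleton a)
  obtain ⟨t, rfl⟩ := Set.ncard_eq_one.1 (hcard.trans (Set.ncard_singleton a))
  rw [← IsLocalization.map_under (Submonoid.powers (PowerSeries.X : R⟦X⟧)) R⸨X⸩ P]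
  exact ⟨algebraMap R⟦X⟧ R⸨X⸩ t, by
    rw [show P.under R⟦X⟧ = Ideal.span {t} from hT, Ideal.map_span, Set.image_singleton]⟩

theorem powerSeries_C_dvd_iff (r : R) (f : R⟦X⟧) :
    PowerSeries.C r ∣ f ↔ PowerSeries.map (Ideal.Quotient.mk (Ideal.span {r})) f = 0 := by
  simp only [PowerSeries.ext_iff, PowerSeries.coeff_map, map_zero, Ideal.Quotient.eq_zero_iff_dvd]
  refine ⟨?_, fun h => ?_⟩
  · rintro ⟨g, rfl⟩ i
    rw [PowerSeries.coeff_C_mul]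
    exact dvd_mul_right _ _
  · choose g hg using h
    exact ⟨PowerSeries.mk g, PowerSeries.ext fun i => by
      rw [PowerSeries.coeff_C_mul, PowerSeries.coeff_mk, hg]⟩

theorem prime_powerSeries_C {r : R} (hr : Prime r) : Prime (PowerSeries.C r : R⟦X⟧) := by
  have := (Ideal.span_singleton_prime hr.ne_zero).2 hr
  refine ⟨(map_ne_zero_iff _ PowerSeries.C_injective).2 hr.ne_zero, fun h => ?_, fun f g h => ?_⟩
  · have := (powerSeries_C_dvd_iff r 1).1 (isUnit_iff_dvd_one.1 h)
    rw [map_one] at this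
    exact one_ne_zero this
  · simpa only [powerSeries_C_dvd_iff, map_mul, mul_eq_zero] using h

theorem prime_laurentSeries_C {r : R} (hr : Prime r) : Prime (HahnSeries.C r : R⸨X⸩) := by
  have hprime := (Ideal.span_singleton_prime (prime_powerSeries_C hr).ne_zero).2
    (prime_powerSeries_C hr)
  have hdisj : Disjoint (Submonoid.powers (PowerSeries.X : R⟦X⟧) : Set R⟦X⟧)
      (Ideal.span {PowerSeries.C r} : Ideal R⟦X⟧) := by
    refine Set.disjoint_left.2 ?_
    rintro _ ⟨n, rfl⟩ h
    obtain ⟨g, hg⟩ := Ideal.mem_span_singleton.1 (hprime.mem_of_pow_mem n h)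
    refine hr.not_isUnit (.of_mul_eq_one (PowerSeries.coeff 1 g) ?_)
    rw [← PowerSeries.coeff_C_mul, ← hg, PowerSeries.coeff_one_X]
  have := IsLocalization.isPrime_of_isPrime_disjoint _ R⸨X⸩ _ hprime hdisj
  rw [Ideal.map_span, Set.image_singleton, LaurentSeries.coe_algebraMap,
    HahnSeries.ofPowerSeries_C] at this
  exact (Ideal.span_singleton_prime
    ((map_ne_zero_iff _ HahnSeries.C_injective).2 hr.ne_zero)).1 this

theorem prime_natCast_laurentSeries {p : ℕ} (hp : p.Prime) : Prime (p : ℤ⸨X⸩) := by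
  simpa only [map_natCast] using prime_laurentSeries_C (Nat.prime_iff_prime_int.1 hp)

theorem natCast_dvd_laurentSeries_iff (n : ℕ) (f : ℤ⸨X⸩) :
    (n : ℤ⸨X⸩) ∣ f ↔ ∀ i, (n : ℤ) ∣ f.coeff i := by
  constructor
  · rintro ⟨g, rfl⟩ i
    rw [← nsmul_eq_mul, HahnSeries.coeff_smul, nsmul_eq_mul]
    exact dvd_mul_right _ _
  · intro h
    let divN : ZeroHom ℤ ℤ := ⟨(· / (n : ℤ)), Int.zero_ediv _⟩
    refine ⟨f.map divN, HahnSeries.ext_iff.2 (funext fun i => ?_)⟩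
    rw [← nsmul_eq_mul, HahnSeries.coeff_smul, nsmul_eq_mul, HahnSeries.map_coeff]
    exact (Int.mul_ediv_cancel' (h i)).symm

end LaurentSeriesRing

section PrimaryDecomposition

variable {R : Type u} [CommRing R]

/-- The direct sum of the cyclic modules `R / (pⁿ)`, where `(p, n)` ranges over a family of pairs
of a prime number and an exponent. The family is meant to be finite, so this is a product. -/
abbrev PrimarySum (R : Type*) [CommRing R] {J : Type*} (c : J → Nat.Primes × ℕ+) : Type _ :=
  (j : J) → R ⧸ Ideal.span {(((c j).1 : ℕ) : R) ^ ((c j).2 : ℕ)}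

theorem natCast_ne_zero_of_forall_prime [IsDomain R] (hR : ∀ p : ℕ, p.Prime → Prime (p : R)) {m : ℕ}
    (hm : m ≠ 0) : (m : R) ≠ 0 := by
  rw [← Nat.prod_primeFactorsList hm, Nat.cast_list_prod]
  refine List.prod_ne_zero fun h => ?_
  obtain ⟨p, hp, hp₀⟩ := List.mem_map.1 h
  exact (hR p (Nat.prime_of_mem_primeFactorsList hp)).ne_zero hp₀

theorem exists_prime_associated_of_dvd_natCast [IsDomain R]
    (hR : ∀ p : ℕ, p.Prime → Prime (p : R)) {q : R} (hq : Prime q) {m : ℕ} (hm : m ≠ 0)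
    (hdvd : q ∣ (m : R)) : ∃ p : Nat.Primes, Associated q (p : ℕ) := by
  rw [← Nat.prod_primeFactorsList hm, Nat.cast_list_prod, hq.dvd_prod_iff] at hdvd
  obtain ⟨_, hmem, hdvd⟩ := hdvd
  obtain ⟨p, hp, rfl⟩ := List.mem_map.1 hmem
  have hp := Nat.prime_of_mem_primeFactorsList hp
  exact ⟨⟨p, hp⟩, hq.irreducible.associated_of_dvd (hR p hp).irreducible hdvd⟩

theorem nonempty_linearEquiv_pi_subtype {J : Type*} (M : J → Type*) [∀ j, AddCommGroup (M j)]
    [∀ j, Module R (M j)] (P : J → Prop) (hM : ∀ j, ¬ P j → Subsingleton (M j)) :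
    Nonempty (((j : J) → M j) ≃ₗ[R] ((j : {j // P j}) → M j)) := by
  classical
  refine ⟨LinearEquiv.ofBijective
    (LinearMap.pi fun j : {j // P j} => LinearMap.proj (R := R) (φ := M) j.1) ⟨fun x y h => ?_,
      fun y => ?_⟩⟩
  · funext j
    by_cases hj : P j
    · exact congrFun h ⟨j, hj⟩
    · exact (hM j hj).elim _ _
  · refine ⟨fun j => if hj : P j then y ⟨j, hj⟩ else 0, funext fun j => ?_⟩
    simp [j.2]

theorem dvd_natCast_of_linearEquiv_pi_quotient {J : Type*} {M : Type*} [AddCommGroup M] [Module R M]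
    {a : J → R} (φ : M ≃ₗ[R] ((j : J) → R ⧸ Ideal.span {a j})) {m : ℕ}
    (hm : ∀ x : M, m • x = 0) (j : J) : a j ∣ (m : R) := by
  classical
  have h : m • (Pi.single j 1 : (j : J) → R ⧸ Ideal.span {a j}) = 0 := by
    rw [← φ.apply_symm_apply (Pi.single j 1), ← map_nsmul, hm, map_zero]
  have := congrFun h j
  rwa [Pi.smul_apply, Pi.single_eq_same, Pi.zero_apply, nsmul_one, ← map_natCast
    (Ideal.Quotient.mk (Ideal.span {a j})), Ideal.Quotient.eq_zero_iff_dvd] at this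

theorem exists_linearEquiv_primarySum [IsDomain R] [IsPrincipalIdealRing R]
    (hR : ∀ p : ℕ, p.Prime → Prime (p : R)) {M : Type*} [AddCommGroup M] [Module R M]
    [Module.Finite R M] {m : ℕ} (hm : 0 < m) (hM : ∀ x : M, m • x = 0) :
    ∃ (J : Type u) (_ : Finite J) (c : J → Nat.Primes × ℕ+), Nonempty (M ≃ₗ[R] PrimarySum R c) := by
  have hm₀ : (m : R) ≠ 0 := natCast_ne_zero_of_forall_prime hR hm.ne'
  have htor : Module.IsTorsion R M := fun x =>
    ⟨⟨m, mem_nonZeroDivisors_of_ne_zero hm₀⟩, (Nat.cast_smul_eq_nsmul R m x).trans (hM x)⟩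
  obtain ⟨ι, _, q, hq, e, ⟨φ⟩⟩ := Module.equiv_directSum_of_isTorsion htor
  let φ' := φ.trans (DirectSum.linearEquivFunOnFintype R ι fun i => R ⧸ R ∙ q i ^ e i)
  have hqp (i : {i // e i ≠ 0}) : ∃ p : Nat.Primes, Associated (q i) (p : ℕ) :=
    exists_prime_associated_of_dvd_natCast hR (hq i).prime hm.ne' <|
      (dvd_pow_self _ i.2).trans (dvd_natCast_of_linearEquiv_pi_quotient φ' hM i)
  choose p hp using hqp
  obtain ⟨ψ⟩ := nonempty_linearEquiv_pi_subtype (R := R) (fun i => R ⧸ R ∙ q i ^ e i)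
    (fun i => e i ≠ 0) fun i hi => by
      rw [not_not.1 hi, pow_zero]
      exact Ideal.Quotient.subsingleton_iff.2 Ideal.span_singleton_one
  refine ⟨{i // e i ≠ 0}, inferInstance, fun i => (p i, ⟨e i, Nat.pos_of_ne_zero i.2⟩),
    ⟨φ'.trans <| ψ.trans <| LinearEquiv.piCongrRight fun i => Submodule.quotEquivOfEq _ _ ?_⟩⟩
  exact Ideal.span_singleton_eq_span_singleton.2 (hp i).pow_pow

end PrimaryDecomposition

section Multiplicities

variable {R : Type*} [CommRing R]

theorem length_quotSMulTop_pi {ι : Type*} [Fintype ι] (r : R) (M : ι → Type*)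
    [∀ i, AddCommGroup (M i)] [∀ i, Module R (M i)] :
    Module.length R (QuotSMulTop r ((i : ι) → M i)) =
      ∑ i, Module.length R (QuotSMulTop r (M i)) := by
  classical
  let φ : QuotSMulTop r ((i : ι) → M i) ≃ₗ[R] ((i : ι) → QuotSMulTop r (M i)) :=
    (QuotSMulTop.equivQuotTensor r _).trans <|
      (TensorProduct.piRight R R (R ⧸ Ideal.span {r}) M).trans <|
        LinearEquiv.piCongrRight fun i => (QuotSMulTop.equivQuotTensor r (M i)).symm
  rw [φ.length_eq, Module.length_pi_of_fintype]

theorem length_quotSMulTop_quotient_span (r s : R) :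
    Module.length R (QuotSMulTop r (R ⧸ Ideal.span {s})) =
      Module.length R (R ⧸ (Ideal.span {s} ⊔ Ideal.span {r})) := by
  have h : r • (⊤ : Submodule R (R ⧸ Ideal.span {s})) =
      Submodule.map (Ideal.span {s}).mkQ (Ideal.span {r}) := by
    rw [← Submodule.ideal_span_singleton_smul, ← Submodule.range_mkQ, LinearMap.range_eq_map,
      ← Submodule.map_smul'', smul_eq_mul, Ideal.mul_top]
  exact ((Submodule.quotEquivOfEq _ _ h).trans
    (Submodule.quotientQuotientEquivQuotientSup _ _)).length_eq

theorem length_quotSMulTop_pow_quotient_span_pow [IsDomain R] [IsPrincipalIdealRing R] {p : R}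
    (hp : Irreducible p) (n j : ℕ) :
    Module.length R (QuotSMulTop (p ^ j) (R ⧸ Ideal.span {p ^ n})) = (min n j : ℕ) := by
  have hsup : Ideal.span {p ^ n} ⊔ Ideal.span {p ^ j} = Ideal.span {p ^ min n j} := by
    rcases le_total n j with h | h
    · rw [min_eq_left h, sup_eq_left]
      exact Ideal.span_singleton_le_span_singleton.2 (pow_dvd_pow p h)
    · rw [min_eq_right h, sup_eq_right]
      exact Ideal.span_singleton_le_span_singleton.2 (pow_dvd_pow p h)
  rw [length_quotSMulTop_quotient_span, hsup]
  change Ring.ord R (p ^ min n j) = _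
  rw [Ring.ord_pow (mem_nonZeroDivisors_of_ne_zero hp.ne_zero), Ring.ord_of_irreducible hp,
    nsmul_one]

theorem length_quotSMulTop_quotient_span_of_isCoprime {r s : R} (h : IsCoprime s r) :
    Module.length R (QuotSMulTop r (R ⧸ Ideal.span {s})) = 0 := by
  have : Subsingleton (R ⧸ (Ideal.span {s} ⊔ Ideal.span {r})) :=
    Ideal.Quotient.subsingleton_iff.2 (Ideal.isCoprime_iff_sup_eq.1
      ((Ideal.isCoprime_span_singleton_iff s r).2 h))
  rw [length_quotSMulTop_quotient_span, Module.length_eq_zero]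

theorem length_quotSMulTop_primarySum [IsDomain R] [IsPrincipalIdealRing R]
    (hR : ∀ p : ℕ, p.Prime → Prime (p : R)) {J : Type*} [Fintype J] (c : J → Nat.Primes × ℕ+)
    (p : Nat.Primes) (k : ℕ) :
    Module.length R (QuotSMulTop (((p : ℕ) : R) ^ k) (PrimarySum R c)) =
      (∑ j, if (c j).1 = p then min ((c j).2 : ℕ) k else 0 : ℕ) := by
  rw [length_quotSMulTop_pi, Nat.cast_sum]
  refine Finset.sum_congr rfl fun j _ => ?_
  split_ifs with h
  · rw [h, length_quotSMulTop_pow_quotient_span_pow (hR p p.2).irreducible]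
  · have hcop : Nat.Coprime (c j).1 p :=
      (Nat.coprime_primes (c j).1.2 p.2).2 fun h' => h (Subtype.ext h')
    exact length_quotSMulTop_quotient_span_of_isCoprime (hcop.cast (R := R)).pow

-- The second difference in `k` of `min n k` is the negative of the indicator function of `n`.
theorem card_fiber_add_sum_min {J : Type*} [Fintype J] (c : J → Nat.Primes × ℕ+) (p : Nat.Primes)
    (n : ℕ+) :
    Nat.card {j // c j = (p, n)} +
        ((∑ j, if (c j).1 = p then min ((c j).2 : ℕ) (n - 1) else 0) +
          ∑ j, if (c j).1 = p then min ((c j).2 : ℕ) (n + 1) else 0) =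
      2 * ∑ j, if (c j).1 = p then min ((c j).2 : ℕ) n else 0 := by
  classical
  rw [Nat.card_eq_fintype_card, Fintype.card_subtype, Finset.card_filter, Finset.mul_sum,
    ← Finset.sum_add_distrib, ← Finset.sum_add_distrib]
  refine Finset.sum_congr rfl fun j _ => ?_
  have := n.pos
  simp only [Prod.ext_iff, ← PNat.coe_inj]
  grind

theorem card_fiber_eq_of_primarySum_linearEquiv [IsDomain R] [IsPrincipalIdealRing R]
    (hR : ∀ p : ℕ, p.Prime → Prime (p : R)) {J K : Type*} [Finite J] [Finite K]
    {c : J → Nat.Primes × ℕ+} {d : K → Nat.Primes × ℕ+} (φ : PrimarySum R c ≃ₗ[R] PrimarySum R d)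
    (q : Nat.Primes × ℕ+) : Nat.card {j // c j = q} = Nat.card {k // d k = q} := by
  have := Fintype.ofFinite J
  have := Fintype.ofFinite K
  obtain ⟨p, n⟩ := q
  have hsum (k : ℕ) : (∑ j, if (c j).1 = p then min ((c j).2 : ℕ) k else 0) =
      ∑ j, if (d j).1 = p then min ((d j).2 : ℕ) k else 0 := by
    have := (QuotSMulTop.congr (((p : ℕ) : R) ^ k) φ).length_eq
    rwa [length_quotSMulTop_primarySum hR, length_quotSMulTop_primarySum hR, Nat.cast_inj] at this
  have hc := card_fiber_add_sum_min c p n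
  rw [hsum, hsum, hsum, ← card_fiber_add_sum_min d p n] at hc
  exact Nat.add_right_cancel hc

end Multiplicities

theorem IsLCATorsionContractionGroup.nonarchimedeanAddGroup {G : Type*} [AddCommGroup G]
    [TopologicalSpace G] {α : G ≃ₜ+ G} (h : IsLCATorsionContractionGroup G α) :
    NonarchimedeanAddGroup G := by
  have := h.isTopologicalAddGroup
  have := h.locallyCompactSpace
  obtain ⟨W, hWc, hWo⟩ := exists_isCompact_isOpen_addSubgroup_of_isTorsion h.isTorsion
  exact IsContraction.nonarchimedeanAddGroup h.contractive hWc hWo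

namespace TwoSidedPower

section Topology

variable {F : Type u} [AddCommGroup F]

/-- The entry at the place `i` of a two-sided sequence. -/
def coord (i : ℤ) : TwoSidedPower F →+ F where
  toFun x := match i with
    | Int.ofNat j => x.2 j
    | Int.negSucc k => x.1 k
  map_zero' := by cases i <;> rfl
  map_add' x y := by cases i <;> rfl

theorem ext_coord {x y : TwoSidedPower F} (h : ∀ i, coord i x = coord i y) : x = y :=
  Prod.ext (Finsupp.ext fun k => h (Int.negSucc k)) (funext fun j => h (Int.ofNat j))

theorem coord_shift (i : ℤ) (x : TwoSidedPower F) : coord i (shift F x) = coord (i - 1) x :=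
  match i with
  | Int.ofNat 0 => rfl
  | Int.ofNat (j + 1) => by rw [show Int.ofNat (j + 1) - 1 = Int.ofNat j by simp]; rfl
  | Int.negSucc k => by rw [show Int.negSucc k - 1 = Int.negSucc (k + 1) by omega]; rfl

theorem exists_forall_coord_eq_zero (x : TwoSidedPower F) : ∃ N : ℤ, ∀ i < N, coord i x = 0 := by
  obtain ⟨N, hN⟩ := x.1.support.bddAbove
  refine ⟨-(N + 1), fun i hi => ?_⟩
  match i with
  | Int.ofNat j => simp only [Int.ofNat_eq_natCast] at hi; omega
  | Int.negSucc k =>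
    by_contra h
    have : k ≤ N := hN (Finset.mem_coe.2 (Finsupp.mem_support_iff.2 h))
    omega

instance : IsTopologicalAddGroup (TwoSidedPower F) := by
  let : TopologicalSpace F := ⊥
  let : TopologicalSpace (ℕ →₀ F) := ⊥
  have : DiscreteTopology F := ⟨rfl⟩
  have : DiscreteTopology (ℕ →₀ F) := ⟨rfl⟩
  exact inferInstanceAs (IsTopologicalAddGroup ((ℕ →₀ F) × (ℕ → F)))

instance : T2Space (TwoSidedPower F) := by
  let : TopologicalSpace F := ⊥
  let : TopologicalSpace (ℕ →₀ F) := ⊥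
  have : DiscreteTopology F := ⟨rfl⟩
  have : DiscreteTopology (ℕ →₀ F) := ⟨rfl⟩
  exact inferInstanceAs (T2Space ((ℕ →₀ F) × (ℕ → F)))

instance [Finite F] : LocallyCompactSpace (TwoSidedPower F) := by
  let : TopologicalSpace F := ⊥
  let : TopologicalSpace (ℕ →₀ F) := ⊥
  have : DiscreteTopology F := ⟨rfl⟩
  have : DiscreteTopology (ℕ →₀ F) := ⟨rfl⟩
  exact inferInstanceAs (LocallyCompactSpace ((ℕ →₀ F) × (ℕ → F)))

theorem continuous_coord [TopologicalSpace F] [DiscreteTopology F] (i : ℤ) :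
    Continuous (coord i : TwoSidedPower F → F) := by
  obtain rfl := DiscreteTopology.eq_bot (α := F)
  let : TopologicalSpace F := ⊥
  let : TopologicalSpace (ℕ →₀ F) := ⊥
  have : DiscreteTopology (ℕ →₀ F) := ⟨rfl⟩
  match i with
  | Int.ofNat j =>
    exact (continuous_apply j).comp (continuous_snd (X := ℕ →₀ F) (Y := ℕ → F))
  | Int.negSucc k =>
    exact (continuous_of_discreteTopology (f := fun u : ℕ →₀ F => u k)).comp
      (continuous_fst (X := ℕ →₀ F) (Y := ℕ → F))

theorem coord_intIterate_shift (k i : ℤ) (x : TwoSidedPower F) :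
    coord i (intIterate (shift F) k x) = coord (i - k) x := by
  have hnat (n : ℕ) (i : ℤ) (x : TwoSidedPower F) :
      coord i (intIterate (shift F) n x) = coord (i - n) x := by
    induction n generalizing i with
    | zero => rw [Nat.cast_zero, intIterate_zero, sub_zero]
    | succ n ih =>
      rw [Nat.cast_succ, add_comm, intIterate_add, intIterate_one, coord_shift, ih, sub_sub]
  obtain ⟨n, rfl | rfl⟩ := k.eq_nat_or_neg
  · exact hnat n i x
  · have := hnat n (i + n) (intIterate (shift F) (-n) x)
    rwa [← intIterate_add, add_neg_cancel, intIterate_zero, add_sub_cancel_right, eq_comm,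
      ← sub_neg_eq_add] at this

theorem isContraction_shift : IsContraction (shift F) := by
  intro x
  obtain ⟨N, hN⟩ := exists_forall_coord_eq_zero x
  have hcoord (i : ℤ) (n : ℕ) (h : i - n < N) : coord i ((shift F : _ → _)^[n] x) = 0 := by
    rw [← intIterate_natCast, coord_intIterate_shift, hN _ h]
  let : TopologicalSpace F := ⊥
  let : TopologicalSpace (ℕ →₀ F) := ⊥
  change Tendsto (fun n => (((shift F : _ → _)^[n] x).1, ((shift F : _ → _)^[n] x).2)) atTop
    (𝓝 ((0 : ℕ →₀ F), (0 : ℕ → F)))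
  refine Tendsto.prodMk_nhds (tendsto_const_nhds.congr' ?_)
    (tendsto_pi_nhds.2 fun j => tendsto_const_nhds.congr' ?_)
  · filter_upwards [eventually_ge_atTop (-N).toNat] with n hn
    exact Finsupp.ext fun k => (hcoord (Int.negSucc k) n (by omega)).symm
  · filter_upwards [eventually_gt_atTop (j - N).toNat] with n hn
    exact (hcoord (Int.ofNat j) n (by simp only [Int.ofNat_eq_natCast]; omega)).symm

theorem isLCATorsionContractionGroup [Finite F] :
    IsLCATorsionContractionGroup (TwoSidedPower F) (shift F) where
  isTopologicalAddGroup := inferInstance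
  t2Space := inferInstance
  locallyCompactSpace := inferInstance
  isTorsion x := isOfFinAddOrder_iff_nsmul_eq_zero.2 ⟨Nat.card F, Nat.card_pos,
    ext_coord fun i => by rw [map_nsmul, card_nsmul_eq_zero', map_zero]⟩
  contractive := isContraction_shift

instance [Finite F] : NonarchimedeanAddGroup (TwoSidedPower F) :=
  isLCATorsionContractionGroup.nonarchimedeanAddGroup

noncomputable instance [Finite F] : Module ℤ⸨X⸩ (TwoSidedPower F) :=
  laurentModule isContraction_shift

theorem isLaurentAction_shift [Finite F] : IsLaurentAction (shift F) :=
  isLaurentAction_laurentModule isContraction_shift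

end Topology

section CyclicModule

variable (q : ℕ)

/-- The two-sided sequence with entry `1` at the place `0` and all other entries zero. -/
def unitSeq : TwoSidedPower (ZMod q) := (0, Pi.single 0 1)

theorem coord_unitSeq_of_ne {i : ℤ} (hi : i ≠ 0) : coord i (unitSeq q) = 0 :=
  match i, hi with
  | Int.ofNat 0, h => (h rfl).elim
  | Int.ofNat (j + 1), _ => Pi.single_eq_of_ne (M := fun _ : ℕ => ZMod q) j.succ_ne_zero 1
  | Int.negSucc _, _ => rfl

variable [NeZero q]

theorem coord_smul_unitSeq (f : ℤ⸨X⸩) (i : ℤ) : coord i (f • unitSeq q) = (f.coeff i : ZMod q) := by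
  let : TopologicalSpace (ZMod q) := ⊥
  have : DiscreteTopology (ZMod q) := ⟨rfl⟩
  refine ((isLaurentAction_shift f (unitSeq q)).map (coord i) (continuous_coord i)).unique ?_
  convert hasSum_single i fun k hk => ?_ using 1
  · rw [Function.comp_apply, laurentTerm, map_zsmul, coord_intIterate_shift, sub_self]
    exact (zsmul_one _).symm
  · rw [Function.comp_apply, laurentTerm, map_zsmul, coord_intIterate_shift,
      coord_unitSeq_of_ne q (sub_ne_zero.2 hk.symm), smul_zero]

theorem smul_unitSeq_surjective : Function.Surjective fun f : ℤ⸨X⸩ => f • unitSeq q := by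
  intro x
  obtain ⟨N, hN⟩ := exists_forall_coord_eq_zero x
  have hsupp : BddBelow (Function.support fun i => ((coord i x).val : ℤ)) := by
    refine ⟨N, fun i hi => ?_⟩
    by_contra! h
    exact hi (by simp [hN i h])
  refine ⟨HahnSeries.ofSuppBddBelow _ hsupp, ext_coord fun i => ?_⟩
  rw [coord_smul_unitSeq, HahnSeries.coeff_ofSuppBddBelow, Int.cast_natCast, ZMod.natCast_zmod_val]

theorem smul_unitSeq_eq_zero_iff (f : ℤ⸨X⸩) : f • unitSeq q = 0 ↔ (q : ℤ⸨X⸩) ∣ f := by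
  rw [natCast_dvd_laurentSeries_iff]
  simp only [← ZMod.intCast_zmod_eq_zero_iff_dvd, ← coord_smul_unitSeq]
  exact ⟨fun h i => by rw [h, map_zero], fun h => ext_coord fun i => by rw [h, map_zero]⟩

theorem nonempty_linearEquiv_quotient :
    Nonempty ((ℤ⸨X⸩ ⧸ Ideal.span {(q : ℤ⸨X⸩)}) ≃ₗ[ℤ⸨X⸩] TwoSidedPower (ZMod q)) := by
  let π := LinearMap.toSpanSingleton ℤ⸨X⸩ (TwoSidedPower (ZMod q)) (unitSeq q)
  have hker : Ideal.span {(q : ℤ⸨X⸩)} = LinearMap.ker π := Submodule.ext fun f => by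
    rw [Ideal.mem_span_singleton, LinearMap.mem_ker, ← smul_unitSeq_eq_zero_iff]
    rfl
  exact ⟨(Submodule.quotEquivOfEq _ _ hker).trans
    (π.quotKerEquivOfSurjective (smul_unitSeq_surjective q))⟩

end CyclicModule

end TwoSidedPower

namespace LaurentSum

variable (ν : Nat.Primes × ℕ+ →₀ ℕ)

instance (q : Nat.Primes × ℕ+) : NeZero ((q.1 : ℕ) ^ (q.2 : ℕ)) :=
  ⟨pow_ne_zero _ q.1.2.ne_zero⟩

theorem intIterate_shift_apply (k : ℤ) (x : LaurentSum ν) (i : SummandIndex ν) :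
    intIterate (shift ν) k x i = intIterate (TwoSidedPower.shift _) k (x i) :=
  map_intIterate (φ := fun x : LaurentSum ν => x i) (fun _ => rfl) k x

theorem isContraction_shift : IsContraction (shift ν) := fun x => tendsto_pi_nhds.2 fun i =>
  (TwoSidedPower.isContraction_shift (x i)).congr fun n => by
    rw [← intIterate_natCast, ← intIterate_natCast, intIterate_shift_apply]

theorem isLCATorsionContractionGroup : IsLCATorsionContractionGroup (LaurentSum ν) (shift ν) where
  isTopologicalAddGroup := inferInstance
  t2Space := inferInstance
  locallyCompactSpace := inferInstance
  isTorsion x := IsOfFinAddOrder.pi fun i =>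
    TwoSidedPower.isLCATorsionContractionGroup.isTorsion (x i)
  contractive := isContraction_shift ν

instance : NonarchimedeanAddGroup (LaurentSum ν) :=
  (isLCATorsionContractionGroup ν).nonarchimedeanAddGroup

theorem isLaurentAction_shift : IsLaurentAction (shift ν) := fun f x => Pi.hasSum.2 fun i => by
  simp only [laurentTerm, Pi.smul_apply, intIterate_shift_apply]
  exact TwoSidedPower.isLaurentAction_shift f (x i)

theorem nonempty_linearEquiv_primarySum :
    Nonempty (LaurentSum ν ≃ₗ[ℤ⸨X⸩] PrimarySum ℤ⸨X⸩ fun i : SummandIndex ν => i.1) :=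
  ⟨LinearEquiv.piCongrRight fun i =>
    (TwoSidedPower.nonempty_linearEquiv_quotient _).some.symm.trans
      (Submodule.quotEquivOfEq _ _ (by rw [Nat.cast_pow]))⟩

end LaurentSum

section Classification

theorem natCard_summandIndex_fiber (ν : Nat.Primes × ℕ+ →₀ ℕ) (q : Nat.Primes × ℕ+) :
    Nat.card {i : SummandIndex ν // i.1 = q} = ν q := by
  rw [Nat.card_congr (Equiv.sigmaSubtype q), Nat.card_fin]

theorem exists_summandIndex_equiv {J : Type*} [Finite J] (c : J → Nat.Primes × ℕ+) :
    ∃ (ν : Nat.Primes × ℕ+ →₀ ℕ) (e : J ≃ SummandIndex ν), ∀ j, (e j).1 = c j := by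
  have hfin : (Function.support fun q => Nat.card {j // c j = q}).Finite := by
    refine (Set.finite_range c).subset fun q hq => ?_
    obtain ⟨⟨j, hj⟩⟩ := (Nat.card_ne_zero.1 hq).1
    exact ⟨j, hj⟩
  exact ⟨Finsupp.ofSupportFinite _ hfin, (Equiv.sigmaFiberEquiv c).symm.trans
    (Equiv.sigmaCongrRight fun q => Finite.equivFin {j // c j = q}), fun _ => rfl⟩

theorem exists_linearEquiv_primarySum_laurentSum {J : Type*} [Finite J]
    (c : J → Nat.Primes × ℕ+) :
    ∃ ν, Nonempty (PrimarySum ℤ⸨X⸩ c ≃ₗ[ℤ⸨X⸩] LaurentSum ν) := by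
  obtain ⟨ν, e, he⟩ := exists_summandIndex_equiv c
  obtain rfl : c = fun j => (e j).1 := funext fun j => (he j).symm
  obtain ⟨φ⟩ := LaurentSum.nonempty_linearEquiv_primarySum ν
  exact ⟨ν, ⟨(LinearEquiv.piCongrLeft ℤ⸨X⸩ (fun i : SummandIndex ν =>
    ℤ⸨X⸩ ⧸ Ideal.span {((i.1.1 : ℕ) : ℤ⸨X⸩) ^ (i.1.2 : ℕ)}) e).trans φ.symm⟩⟩

theorem IsLCATorsionContractionGroup.exists_contractionIso {G : Type*} [AddCommGroup G]
    [TopologicalSpace G] {α : G ≃ₜ+ G} (h : IsLCATorsionContractionGroup G α) :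
    ∃ ν, ContractionIso α (LaurentSum.shift ν) := by
  have := h.nonarchimedeanAddGroup
  have := h.t2Space
  have := h.locallyCompactSpace
  have hα : IsContraction α := h.contractive
  let : Module ℤ⸨X⸩ G := laurentModule hα
  have hact : IsLaurentAction α := isLaurentAction_laurentModule hα
  have := hα.finite_of_isLaurentAction hact
  obtain ⟨m, hm, hmG⟩ := hα.exists_nsmul_eq_zero h.isTorsion
  obtain ⟨J, _, c, ⟨φ⟩⟩ := exists_linearEquiv_primarySum (R := ℤ⸨X⸩)
    (fun _ => prime_natCast_laurentSeries) hm hmG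
  obtain ⟨ν, ⟨ψ⟩⟩ := exists_linearEquiv_primarySum_laurentSum c
  exact ⟨ν, hα.contractionIso_of_linearEquiv (LaurentSum.isContraction_shift ν) hact
    (LaurentSum.isLaurentAction_shift ν) (φ.trans ψ)⟩

theorem LaurentSum.eq_of_contractionIso {ν μ : Nat.Primes × ℕ+ →₀ ℕ}
    (h : ContractionIso (shift ν) (shift μ)) : ν = μ := by
  obtain ⟨φ⟩ := (isLaurentAction_shift ν).nonempty_linearEquiv (isLaurentAction_shift μ) h
  obtain ⟨ψν⟩ := nonempty_linearEquiv_primarySum ν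
  obtain ⟨ψμ⟩ := nonempty_linearEquiv_primarySum μ
  ext q
  rw [← natCard_summandIndex_fiber ν, ← natCard_summandIndex_fiber μ]
  exact card_fiber_eq_of_primarySum_linearEquiv (fun _ => prime_natCast_laurentSeries)
    (ψν.symm.trans (φ.trans ψμ)) q

end Classification

section ContractionIso

variable {G H K : Type*} [AddCommGroup G] [TopologicalSpace G] [AddCommGroup H]
  [TopologicalSpace H] [AddCommGroup K] [TopologicalSpace K]
  {α : G ≃ₜ+ G} {β : H ≃ₜ+ H} {γ : K ≃ₜ+ K}

theorem ContractionIso.symm : ContractionIso α β → ContractionIso β α := by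
  rintro ⟨φ, hφ⟩
  refine ⟨φ.symm, fun y => φ.injective ?_⟩
  rw [hφ, φ.apply_symm_apply, φ.apply_symm_apply]

theorem ContractionIso.trans : ContractionIso α β → ContractionIso β γ → ContractionIso α γ := by
  rintro ⟨φ, hφ⟩ ⟨ψ, hψ⟩
  refine ⟨φ.trans ψ, fun x => ?_⟩
  change ψ (φ (α x)) = γ (ψ (φ x))
  rw [hφ, hψ]

end ContractionIso

theorem corollary5 :
    (∀ ν : Nat.Primes × ℕ+ →₀ ℕ,
      IsLCATorsionContractionGroup (LaurentSum ν) (LaurentSum.shift ν)) ∧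
    (∀ (G : Type u) [AddCommGroup G] [TopologicalSpace G] (α : G ≃ₜ+ G),
      IsLCATorsionContractionGroup G α →
        ∃! ν : Nat.Primes × ℕ+ →₀ ℕ, ContractionIso α (LaurentSum.shift ν)) ∧
    Countable (Quotient LCATorsionContractionGroup.isoSetoid.{u}) := by
  refine ⟨LaurentSum.isLCATorsionContractionGroup, fun G _ _ α h => ?_, ?_⟩
  · obtain ⟨ν, hν⟩ := h.exists_contractionIso
    exact ⟨ν, hν, fun μ hμ => LaurentSum.eq_of_contractionIso (hμ.symm.trans hν)⟩
  · choose ν hν using fun A : LCATorsionContractionGroup.{u} => A.prop.exists_contractionIso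
    have hiso (A B : LCATorsionContractionGroup.{u}) (h : ν A = ν B) : A ≈ B :=
      (h ▸ hν A).trans (hν B).symm
    have hinj : Function.Injective fun a : Quotient LCATorsionContractionGroup.isoSetoid.{u} =>
        ν a.out := fun a b h => Quotient.out_equiv_out.1 (hiso _ _ h)
    exact hinj.countable
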